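/- **Setting.** Let $V$ be a finite set of $n$ vertices, let $l\ge 0$, $T\ge 2$ and $k_v\ge 0$ ($v\in V$) be integers. For every $v$ and every $i\in\{1,\dots,k_v\}$ a walk $(v,i)$ of length $l$ starting at $v$ is maintained during time steps $1,\dots,T$. At each time $t$ an adaptive adversary chooses, as a function of the whole history up to time $t-1$ (all earlier graphs, sampled sets and realizations of the walks), a simple undirected graph $G_t$ on $V$ (so $G_t$ arises from $G_{t-1}$ by arbitrary edge insertions and deletions) and a set of walks to be resampled. The walks *sampled by the adversary* at time $t$ are all walks if $t=1$, and, if $t\ge 2$, the chosen ones together with all walks that traverse an edge of $G_{t-1}$ that is not an edge of $G_t$. In *landmark resampling*, whenever a walk is sampled by the adversary at a time $t_0$, the algorithm schedules resamples of it at times $t_1,t_2,\dots$, where $t_i=t_{i-1}+2^i+x$ with $x\in\{0,\dots,2^i\}$ chosen to maximize the number of trailing zeros of the binary expansion of $t_i$. (The result holds both if a new adversarial sample of a walk cancels the pending schedules of that walk and if all schedules stay in force.) At time $t$, each walk $(v,i)$ that is sampled by the adversary or scheduled for time $t$ is replaced by a fresh $l$-step simple random walk in $G_t$ from $v$, independently;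 all other walks are kept. The *congestion* of an edge at time $t$ is the number of maintained walks that traverse it. **Theorem.** For every $c>0$ there is a constant $C>0$, depending only on $c$, such that the following holds for all $V,l,T,(k_v)$ as above and every adaptive adversary for which almost surely $k_v\le \min_{1\le t\le T}\deg_{G_t}(v)$ for all $v\in V$: under landmark resampling, with probability at least $1-n^{-c}$, every edge of $G_T$ has congestion at most $C\cdot\log T\cdot\log n\cdot l$ at time $T$. -/

import Mathlib

namespace DynamicWalks

/-- Identifiers of the maintained walks: `⟨v, i⟩` is the `i`-th walk starting at `v`, and
`k v` walks start at `v`. -/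
abbrev WalkId (V : Type*) (k : V → ℕ) : Type _ := Σ v : V, Fin (k v)

/-- One step of the simple random walk on `G` from `v`: a uniformly random neighbour of `v`.
At an isolated vertex (where no neighbour exists) the walk stays put. -/
noncomputable def stepLaw {V : Type*} [Fintype V] (G : SimpleGraph V) (v : V) : PMF V :=
  open Classical in
  if h : (G.neighborSet v).toFinite.toFinset.Nonempty then
    PMF.uniformOfFinset (G.neighborSet v).toFinite.toFinset h
  else PMF.pure v

/-- The law of the simple random walk of length `l` (that is, with `l` steps) on `G` from `v`,
given by its sequence of `l + 1` visited vertices. -/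
noncomputable def walkLaw {V : Type*} [Fintype V] (G : SimpleGraph V) :
    (l : ℕ) → V → PMF (Fin (l + 1) → V)
  | 0, v => PMF.pure fun _ => v
  | l + 1, v => (stepLaw G v).bind fun w =>
      (walkLaw G l w).map fun p => (Fin.cons v p : Fin (l + 1 + 1) → V)

/-- The joint law of independent random variables with laws `p i`. -/
noncomputable def productLaw {ι α : Type*} [Fintype ι] [Fintype α] (p : ι → PMF α) :
    PMF (ι → α) :=
  open Classical in
  PMF.ofFintype (fun w => ∏ i, p i (w i)) (by
    classical
    have h := Finset.prod_univ_sum (fun _ : ι => (Finset.univ : Finset α))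
      (fun i a => p i a)
    simp only [Fintype.piFinset_univ] at h
    rw [← h]
    refine Finset.prod_eq_one fun i _ => ?_
    rw [← tsum_fintype (L := .unconditional α)]
    exact (p i).tsum_coe)

/-- The vertex sequence `p` traverses the (undirected) edge `e`. -/
def Traverses {V : Type*} {l : ℕ} (p : Fin (l + 1) → V) (e : Sym2 V) : Prop :=
  ∃ j : Fin l, s(p j.castSucc, p j.succ) = e

/-- What happens in one time step: the current graph, the set of walks that count as sampled
by the adversary in this step, and the realizations of all walks at the end of the step. -/
structure Snapshot (V : Type*) (k : V → ℕ) (l : ℕ) where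
  graph : SimpleGraph V
  advSampled : Set (WalkId V k)
  walk : WalkId V k → Fin (l + 1) → V

/-- The congestion of `e`: the number of walks that traverse `e`. -/
noncomputable def Snapshot.congestion {V : Type*} {k : V → ℕ} {l : ℕ}
    (S : Snapshot V k l) (e : Sym2 V) : ℕ :=
  {u : WalkId V k | Traverses (S.walk u) e}.ncard

/-- Histories of the time steps `1, …, t`; the index `s : Fin t` stands for time `s + 1`. -/
abbrev History (V : Type*) (k : V → ℕ) (l t : ℕ) : Type _ := Fin t → Snapshot V k l

/-- An adaptive adversary: from the whole history up to time `t` it chooses the graph of time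
`t + 1` (an arbitrary set of edge insertions and deletions) and a set of walks that it wants to
be resampled at time `t + 1`. -/
structure Adversary (V : Type*) (k : V → ℕ) (l : ℕ) where
  nextGraph : {t : ℕ} → History V k l t → SimpleGraph V
  request : {t : ℕ} → History V k l t → Set (WalkId V k)

/-- The walks sampled by the adversary at time `t + 1`: all walks at time `1`; later the
requested ones and those that traverse an edge which is deleted in this step. -/
def Adversary.sampled {V : Type*} {k : V → ℕ} {l : ℕ} (A : Adversary V k l) :
    {t : ℕ} → History V k l t → Set (WalkId V k)
  | 0, _ => Set.univ
  | t + 1, h => A.request h ∪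
      {u | ∃ e ∈ (h (Fin.last t)).graph.edgeSet \ (A.nextGraph h).edgeSet,
        Traverses ((h (Fin.last t)).walk u) e}

/-- The walks carried over from a history. The value on the empty history is irrelevant, since
all walks are sampled at time `1`. -/
def currentWalk {V : Type*} {k : V → ℕ} {l : ℕ} :
    {t : ℕ} → History V k l t → WalkId V k → Fin (l + 1) → V
  | 0, _, u => fun _ => u.1
  | t + 1, h, u => (h (Fin.last t)).walk u

theorem exists_max_trailing_zeros (i s : ℕ) : ∃ x ∈ Finset.range (2 ^ i + 1),
    ∀ y ∈ Finset.range (2 ^ i + 1),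
      padicValNat 2 (s + 2 ^ i + y) ≤ padicValNat 2 (s + 2 ^ i + x) :=
  Finset.exists_max_image _ (fun x => padicValNat 2 (s + 2 ^ i + x)) ⟨0, by simp⟩

/-- `s + 2 ^ i + x` with `0 ≤ x ≤ 2 ^ i` chosen so that the number of trailing binary zeros of
the result is as large as possible (such an `x` is unique). -/
noncomputable def landmarkNext (i s : ℕ) : ℕ :=
  s + 2 ^ i + (exists_max_trailing_zeros i s).choose

/-- The times `t₀, t₁, t₂, …` of landmark resampling for a sample made at time `t₀`. -/
noncomputable def landmarkTime (t₀ : ℕ) : ℕ → ℕ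
  | 0 => t₀
  | i + 1 => landmarkNext (i + 1) (landmarkTime t₀ i)

/-- The walks that landmark resampling resamples at time `t + 1`: those `u` for which `t + 1` is
one of the times `t₁, t₂, …` scheduled because of an adversarial sample of `u` at some
`t₀ ≤ t`. If `cancel` is true, an adversarial sample of `u` cancels what is still pending from
earlier samples of `u`; if it is false, all schedules stay in force. -/
def landmarkSampled {V : Type*} {k : V → ℕ} {l t : ℕ} (cancel : Bool)
    (h : History V k l t) : Set (WalkId V k) :=
  {u | ∃ s : Fin t, u ∈ (h s).advSampled ∧
    (cancel = true → ∀ s' : Fin t, s < s' → u ∉ (h s').advSampled) ∧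
    ∃ i : ℕ, 1 ≤ i ∧ landmarkTime (s + 1) i = t + 1}

/-- The joint law of the walks at time `t + 1` given the history: walks sampled by the adversary
or by the algorithm are drawn afresh in the new graph, independently; the others are kept. -/
noncomputable def nextWalksLaw {V : Type*} [Fintype V] {k : V → ℕ} {l t : ℕ} (cancel : Bool)
    (A : Adversary V k l) (h : History V k l t) : PMF (WalkId V k → Fin (l + 1) → V) :=
  open Classical in
  productLaw fun u =>
    if u ∈ A.sampled h ∪ landmarkSampled cancel h then walkLaw (A.nextGraph h) l u.1
    else PMF.pure (currentWalk h u)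

/-- The law of the history of the first `t` time steps, when landmark resampling plays against
the adversary `A`. -/
noncomputable def historyLaw {V : Type*} [Fintype V] {k : V → ℕ} {l : ℕ} (cancel : Bool)
    (A : Adversary V k l) : (t : ℕ) → PMF (History V k l t)
  | 0 => PMF.pure Fin.elim0
  | t + 1 => (historyLaw cancel A t).bind fun h =>
      (nextWalksLaw cancel A h).map fun w =>
        (Fin.snoc h ⟨A.nextGraph h, A.sampled h, w⟩ : Fin (t + 1) → Snapshot V k l)

end DynamicWalks

/-!
Three facts give the bound.

*Few relevant times.* The `i`-th time of a schedule is a multiple of `2 ^ i`, and the next one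
follows within `2 ^ (i + 2)` steps. At time `T` the last resampling of any walk belongs to a schedule
that is still in force and whose next time exceeds `T` (`exists_schedule_of_mem_support`). Hence the
last resampling times of all walks lie in a fixed set `landmarks T` of at most
`4 * (Nat.log 2 T + 1)` times (`card_filter_landmarks_le`), whatever the adversary does. So the
congestion of `e` is at most the `load` of `e`: the number of walks that traverse `e` right after a
resampling at a time in `landmarks T` (`congestion_le_load`). Unlike the set of walks whose *last*
resampling is at a given time, each summand of the load does not depend on later choices of the
adversary.

*Stationarity.* If at most `deg v` walks of length `l` start at each `v`, then the expected number
of those that traverse a given edge is at most `2 * l`, since `deg` is a stationary measure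
under which a step crosses the edge with mass one in each direction
(`sum_degree_mul_traverseProb_le`).

*Exponential moments.* Given the past, the walks resampled at one time are independent, so the
number `X` of those that traverse `e` satisfies `𝔼 (2 ^ X) ≤ exp (2 * l)`. Multiplying these
conditional bounds along the history gives `𝔼 (2 ^ load) ≤ exp (2 * l * |landmarks T|)` against an
adaptive adversary (`tsum_historyLaw_mul_two_pow_load_le`). Markov's inequality and a union bound
over all pairs of vertices finish the proof.
-/

open scoped ENNReal

namespace DynamicWalks

/-! ### Traversal probabilities of a random walk -/

theorem traverses_cons {V : Type*} {l : ℕ} (v : V) (p : Fin (l + 1) → V) (e : Sym2 V) :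
    Traverses (l := l + 1) (Fin.cons v p) e ↔ s(v, p 0) = e ∨ Traverses p e := by
  unfold Traverses
  rw [Fin.exists_fin_succ]
  rfl

theorem apply_zero_of_mem_support_walkLaw {V : Type*} [Fintype V] (G : SimpleGraph V) {l : ℕ}
    {v : V} {p : Fin (l + 1) → V} (hp : p ∈ (walkLaw G l v).support) : p 0 = v := by
  cases l with
  | zero =>
    rw [walkLaw, PMF.mem_support_pure_iff] at hp
    rw [hp]
  | succ l =>
    rw [walkLaw, PMF.mem_support_bind_iff] at hp
    obtain ⟨w, -, hw⟩ := hp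
    rw [PMF.mem_support_map_iff] at hw
    obtain ⟨q, -, rfl⟩ := hw
    rfl

theorem toOuterMeasure_le_one {α : Type*} (p : PMF α) (s : Set α) : p.toOuterMeasure s ≤ 1 := by
  rw [PMF.toOuterMeasure_apply, ← p.tsum_coe]
  exact ENNReal.tsum_le_tsum fun a => Set.indicator_le_self _ _ a

/-- The probability that the `l`-step walk from `v` traverses `e`. -/
noncomputable def traverseProb {V : Type*} [Fintype V] (G : SimpleGraph V) (l : ℕ) (e : Sym2 V)
    (v : V) : ℝ≥0∞ :=
  (walkLaw G l v).toOuterMeasure {p | Traverses p e}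

theorem traverseProb_zero {V : Type*} [Fintype V] (G : SimpleGraph V) (e : Sym2 V) (v : V) :
    traverseProb G 0 e v = 0 := by
  have : {p : Fin (0 + 1) → V | Traverses p e} = ∅ := by
    ext p
    simp [Traverses]
  rw [traverseProb, this]
  simp

open Classical in
theorem traverseProb_succ_le {V : Type*} [Fintype V] (G : SimpleGraph V) (l : ℕ) (e : Sym2 V)
    (v : V) : traverseProb G (l + 1) e v ≤
      ∑ w, stepLaw G v w * ((if s(v, w) = e then 1 else 0) + traverseProb G l e w) := by
  rw [traverseProb, walkLaw, PMF.toOuterMeasure_bind_apply, tsum_fintype]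
  refine Finset.sum_le_sum fun w _ => ?_
  gcongr
  rw [PMF.toOuterMeasure_map_apply]
  split_ifs with h
  · exact (toOuterMeasure_le_one _ _).trans le_self_add
  · rw [zero_add]
    refine PMF.toOuterMeasure_mono _ ?_
    rintro p ⟨hp, hs⟩
    rcases (traverses_cons v p e).1 hp with h' | h'
    · rw [apply_zero_of_mem_support_walkLaw G hs] at h'
      exact absurd h' h
    · exact h'

open Classical in
theorem ncard_mul_stepLaw {V : Type*} [Fintype V] (G : SimpleGraph V) (v w : V) :
    ((G.neighborSet v).ncard : ℝ≥0∞) * stepLaw G v w = if G.Adj v w then 1 else 0 := by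
  have hc := Set.ncard_eq_toFinset_card (G.neighborSet v) (Set.toFinite _)
  unfold stepLaw
  split_ifs with h h' h'
  · rw [PMF.uniformOfFinset_apply_of_mem _ (by simpa using h'), hc]
    exact ENNReal.mul_inv_cancel (by simpa using h.card_ne_zero) (ENNReal.natCast_ne_top _)
  · rw [PMF.uniformOfFinset_apply_of_notMem _ (by simpa using h'), mul_zero]
  · exact absurd ⟨w, by simpa using h'⟩ h
  · rw [hc, Finset.not_nonempty_iff_eq_empty.1 h]
    simp

/-- Started from the (unnormalised) stationary measure `deg`, the walk crosses `e` in each step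
with total mass at most one in either direction, so that the mass of the walks that traverse `e` is
at most `2 * l`. -/
theorem sum_degree_mul_traverseProb_le {V : Type*} [Fintype V] (G : SimpleGraph V) (l : ℕ)
    (e : Sym2 V) :
    ∑ v, ((G.neighborSet v).ncard : ℝ≥0∞) * traverseProb G l e v ≤ 2 * l := by
  classical
  induction l with
  | zero => simp [traverseProb_zero]
  | succ l ih =>
    have hcross : ∑ v, ∑ w, (if G.Adj v w then 1 else 0) * (if s(v, w) = e then 1 else 0)
        ≤ (2 : ℝ≥0∞) := by
      induction e using Sym2.inductionOn with
      | _ x y =>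
      rw [← Fintype.sum_prod_type'
        (f := fun v w => (if G.Adj v w then (1 : ℝ≥0∞) else 0) *
          (if s(v, w) = s(x, y) then 1 else 0))]
      calc _ ≤ ∑ z : V × V, (if z ∈ ({(x, y), (y, x)} : Finset (V × V)) then (1 : ℝ≥0∞) else 0) := by
            refine Finset.sum_le_sum fun z _ => ?_
            obtain ⟨v, w⟩ := z
            have : s(v, w) = s(x, y) ↔ (v, w) ∈ ({(x, y), (y, x)} : Finset (V × V)) := by
              simp [Prod.ext_iff]
            simp only [this]
            split_ifs <;> simp
        _ ≤ 2 := by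
            rw [Finset.sum_boole]
            norm_cast
            refine le_trans (Finset.card_le_card (t := {(x, y), (y, x)}) ?_) Finset.card_le_two
            intro z hz
            simpa using hz
    have hstat : ∑ v, ∑ w, (if G.Adj v w then 1 else 0) * traverseProb G l e w ≤ 2 * l := by
      refine le_trans (le_of_eq ?_) ih
      rw [Finset.sum_comm]
      refine Finset.sum_congr rfl fun w _ => ?_
      rw [← Finset.sum_mul, Finset.sum_boole, Set.ncard_eq_toFinset_card' (G.neighborSet w)]
      congr 3
      ext v
      simp [G.adj_comm]
    calc _ ≤ ∑ v, ((G.neighborSet v).ncard : ℝ≥0∞) * ∑ w, stepLaw G v w *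
            ((if s(v, w) = e then 1 else 0) + traverseProb G l e w) := by
          gcongr with v
          exact traverseProb_succ_le G l e v
      _ = ∑ v, ∑ w, (if G.Adj v w then 1 else 0) * (if s(v, w) = e then 1 else 0) +
          ∑ v, ∑ w, (if G.Adj v w then 1 else 0) * traverseProb G l e w := by
          simp_rw [Finset.mul_sum, ← mul_assoc, ncard_mul_stepLaw, mul_add,
            Finset.sum_add_distrib]
      _ ≤ 2 + 2 * l := add_le_add hcross hstat
      _ = _ := by push_cast; ring

theorem sum_walkId_traverseProb_le {V : Type*} [Fintype V] (G : SimpleGraph V) {k : V → ℕ}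
    (hk : ∀ v, k v ≤ (G.neighborSet v).ncard) (l : ℕ) (e : Sym2 V) :
    ∑ u : WalkId V k, traverseProb G l e u.1 ≤ 2 * l := by
  refine le_trans ?_ (sum_degree_mul_traverseProb_le G l e)
  rw [Fintype.sum_sigma]
  refine Finset.sum_le_sum fun v _ => ?_
  simp only [Finset.sum_const, Finset.card_univ, Fintype.card_fin, nsmul_eq_mul]
  gcongr
  exact hk v

/-! ### The number of fresh walks through an edge -/

theorem one_add_le_ofReal_exp {q : ℝ≥0∞} (hq : q ≠ ∞) :
    1 + q ≤ ENNReal.ofReal (Real.exp q.toReal) := by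
  conv_lhs => rw [← ENNReal.ofReal_toReal hq, ← ENNReal.ofReal_one,
    ← ENNReal.ofReal_add zero_le_one ENNReal.toReal_nonneg]
  refine ENNReal.ofReal_le_ofReal ?_
  rw [add_comm]
  exact Real.add_one_le_exp _

theorem productLaw_apply {ι α : Type*} [Fintype ι] [Fintype α] (p : ι → PMF α) (w : ι → α) :
    productLaw p w = ∏ i, p i (w i) := rfl

theorem sum_productLaw_mul_prod {ι α : Type*} [Fintype ι] [Fintype α] (p : ι → PMF α)
    (f : ι → α → ℝ≥0∞) :
    ∑' w, productLaw p w * ∏ i, f i (w i) = ∏ i, ∑ a, p i a * f i a := by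
  classical
  rw [tsum_fintype, Finset.prod_univ_sum, Fintype.piFinset_univ]
  simp only [productLaw_apply, Finset.prod_mul_distrib]

open Classical in
theorem sum_mul_ite_two_one {α : Type*} [Fintype α] (p : PMF α) (s : Set α) :
    ∑ a, p a * (if a ∈ s then 2 else 1) = 1 + p.toOuterMeasure s := by
  have h1 : ∑ a, p a = 1 := by rw [← tsum_fintype (L := .unconditional _), p.tsum_coe]
  rw [PMF.toOuterMeasure_apply_fintype, ← h1, ← Finset.sum_add_distrib]
  refine Finset.sum_congr rfl fun a _ => ?_
  by_cases h : a ∈ s <;> simp [h, h1, mul_two]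

/-- If the walks in `R` are drawn afresh, then the number `X` of those that traverse `e` satisfies
`𝔼 (2 ^ X) ≤ exp (2 * l)`. -/
theorem tsum_productLaw_mul_two_pow_le {V : Type*} [Fintype V] (G : SimpleGraph V) {k : V → ℕ}
    (hk : ∀ v, k v ≤ (G.neighborSet v).ncard) (l : ℕ) (e : Sym2 V) (R : Set (WalkId V k))
    (p : WalkId V k → PMF (Fin (l + 1) → V)) (hp : ∀ u ∈ R, p u = walkLaw G l u.1) :
    ∑' w, productLaw p w * 2 ^ {u | u ∈ R ∧ Traverses (w u) e}.ncard ≤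
      ENNReal.ofReal (Real.exp (2 * l)) := by
  classical
  have hpow (w : WalkId V k → Fin (l + 1) → V) :
      (2 : ℝ≥0∞) ^ {u | u ∈ R ∧ Traverses (w u) e}.ncard =
        ∏ u, if u ∈ R ∧ w u ∈ {p | Traverses p e} then 2 else 1 := by
    rw [Finset.prod_ite, Finset.prod_const, Finset.prod_const_one, mul_one,
      Set.ncard_eq_toFinset_card']
    congr 2
    ext u
    simp
  have hq (u : WalkId V k) : traverseProb G l e u.1 ≠ ∞ :=
    ((toOuterMeasure_le_one _ _).trans_lt ENNReal.one_lt_top).ne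
  simp_rw [hpow]
  rw [sum_productLaw_mul_prod p (fun u a => if u ∈ R ∧ a ∈ {p | Traverses p e} then 2 else 1)]
  calc _ ≤ ∏ u : WalkId V k, ENNReal.ofReal (Real.exp (traverseProb G l e u.1).toReal) := by
        refine Finset.prod_le_prod' fun u _ => le_trans ?_ (one_add_le_ofReal_exp (hq u))
        by_cases hu : u ∈ R
        · simp only [hu, true_and]
          rw [sum_mul_ite_two_one, hp u hu, traverseProb]
        · simp only [hu, false_and, if_false, mul_one]
          rw [← tsum_fintype (L := .unconditional _), (p u).tsum_coe]
          exact le_self_add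
    _ = ENNReal.ofReal (Real.exp (∑ u : WalkId V k, traverseProb G l e u.1).toReal) := by
        rw [← ENNReal.ofReal_prod_of_nonneg fun _ _ => (Real.exp_pos _).le, ← Real.exp_sum,
          ENNReal.toReal_sum fun u _ => hq u]
    _ ≤ _ := by
        refine ENNReal.ofReal_le_ofReal (Real.exp_le_exp.2 ?_)
        have h := ENNReal.toReal_mono (by finiteness) (sum_walkId_traverseProb_le G hk l e)
        simpa using h

/-! ### The landmarks of a time -/

theorem landmarkNext_bounds (i s : ℕ) :
    s + 2 ^ i ≤ landmarkNext i s ∧ landmarkNext i s ≤ s + 2 ^ (i + 1) := by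
  have h := (exists_max_trailing_zeros i s).choose_spec.1
  rw [Finset.mem_range] at h
  unfold landmarkNext
  rw [pow_succ]
  omega

/-- Among `2 ^ i + 1` consecutive numbers there is a multiple of `2 ^ i`, so that the number with
the most trailing zeros is one. -/
theorem two_pow_dvd_landmarkNext (i s : ℕ) : 2 ^ i ∣ landmarkNext i s := by
  have hpos : 0 < 2 ^ i := by positivity
  have hmax := (exists_max_trailing_zeros i s).choose_spec.2
  have hmod := Nat.mod_lt (s + 2 ^ i) hpos
  have hdiv := Nat.div_add_mod (s + 2 ^ i) (2 ^ i)
  have h := hmax (2 ^ i - (s + 2 ^ i) % 2 ^ i) (by rw [Finset.mem_range]; omega)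
  have hd : 2 ^ i ∣ s + 2 ^ i + (2 ^ i - (s + 2 ^ i) % 2 ^ i) :=
    ⟨(s + 2 ^ i) / 2 ^ i + 1, by rw [mul_add, mul_one]; omega⟩
  rw [padicValNat_dvd_iff_le (by positivity)] at hd
  have hle := (landmarkNext_bounds i s).1
  exact (padicValNat_dvd_iff_le (by omega)).2 (hd.trans h)

theorem two_pow_dvd_landmarkTime (t₀ i : ℕ) : 2 ^ i ∣ landmarkTime t₀ i := by
  cases i with
  | zero => simp
  | succ i => exact two_pow_dvd_landmarkNext _ _

theorem landmarkTime_lt_succ (t₀ i : ℕ) : landmarkTime t₀ i < landmarkTime t₀ (i + 1) :=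
  lt_of_lt_of_le (Nat.lt_add_of_pos_right (by positivity)) (landmarkNext_bounds (i + 1) _).1

theorem le_landmarkTime (t₀ i : ℕ) : t₀ ≤ landmarkTime t₀ i :=
  (strictMono_nat_of_lt_succ (landmarkTime_lt_succ t₀)).monotone (Nat.zero_le i)

/-- The times that can be the last time up to `t` of a schedule: multiples `s` of `2 ^ i`, for
some `i`, with `t - 2 ^ (i + 2) < s ≤ t`. -/
def landmarks (t : ℕ) : Set ℕ :=
  {s | 0 < s ∧ s ≤ t ∧ ∃ i, 2 ^ i ∣ s ∧ t < s + 2 ^ (i + 2)}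

/-- For each `i` at most four multiples of `2 ^ i` qualify, and `2 ^ i ≤ t`. -/
theorem card_filter_landmarks_le (t : ℕ) [DecidablePred (· ∈ landmarks t)] :
    ((Finset.Icc 1 t).filter (· ∈ landmarks t)).card ≤ 4 * (Nat.log 2 t + 1) := by
  have hsub : (Finset.Icc 1 t).filter (· ∈ landmarks t) ⊆
      (Finset.range (Nat.log 2 t + 1) ×ˢ Finset.range 4).image
        (fun z => 2 ^ z.1 * (t / 2 ^ z.1 - z.2)) := by
    intro s hs
    obtain ⟨-, hs0, hst, i, ⟨m, rfl⟩, hi⟩ := Finset.mem_filter.1 hs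
    have hpos : 0 < 2 ^ i := by positivity
    have hm : m ≤ t / 2 ^ i := by
      rw [Nat.le_div_iff_mul_le hpos, mul_comm]
      exact hst
    have hlt : t / 2 ^ i < m + 4 := by
      rw [Nat.div_lt_iff_lt_mul hpos]
      calc t < 2 ^ i * m + 2 ^ (i + 2) := hi
        _ = (m + 4) * 2 ^ i := by ring
    have hlog : i ≤ Nat.log 2 t :=
      Nat.le_log_of_pow_le one_lt_two
        ((Nat.le_mul_of_pos_right _ (Nat.pos_of_mul_pos_left hs0)).trans hst)
    simp only [Finset.mem_image, Finset.mem_product, Finset.mem_range]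
    refine ⟨(i, t / 2 ^ i - m), ⟨by simpa using Nat.lt_succ_of_le hlog, by simp; omega⟩, ?_⟩
    simp only
    rw [Nat.sub_sub_self hm]
  refine (Finset.card_le_card hsub).trans (Finset.card_image_le.trans ?_)
  rw [Finset.card_product, Finset.card_range, Finset.card_range, mul_comm]

variable {V : Type*} {k : V → ℕ} {l : ℕ}

/-! ### The last resampling time of a walk -/

/-- The walks that are resampled, by the adversary or by the algorithm, in the last step of a
nonempty history. -/
def resampled (cancel : Bool) {t : ℕ} (h : History V k l (t + 1)) : Set (WalkId V k) :=
  (h (Fin.last t)).advSampled ∪ landmarkSampled cancel (Fin.init h : History V k l t)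

open Classical in
/-- The last time at which the walk `u` is resampled in a history, and `0` if there is none. -/
noncomputable def lastTime (cancel : Bool) : {t : ℕ} → History V k l t → WalkId V k → ℕ
  | 0, _, _ => 0
  | t + 1, h, u =>
    if u ∈ resampled cancel h then t + 1 else lastTime cancel (Fin.init h : History V k l t) u

open Classical in
/-- The number of pairs of a time in `L` and a walk that is resampled at this time and then
traverses `e`. -/
noncomputable def load (cancel : Bool) (L : Set ℕ) (e : Sym2 V) : {t : ℕ} → History V k l t → ℕ
  | 0, _ => 0
  | t + 1, h => load cancel L e (Fin.init h : History V k l t) +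
      if t + 1 ∈ L then
        {u | u ∈ resampled cancel h ∧ Traverses ((h (Fin.last t)).walk u) e}.ncard else 0

theorem resampled_snoc (cancel : Bool) {t : ℕ} (h : History V k l t) (S : Snapshot V k l) :
    resampled cancel (Fin.snoc h S : History V k l (t + 1)) =
      S.advSampled ∪ landmarkSampled cancel h := by
  have h1 : (Fin.snoc h S : History V k l (t + 1)) (Fin.last t) = S := Fin.snoc_last ..
  have h2 : (Fin.init (Fin.snoc h S : History V k l (t + 1)) : History V k l t) = h :=
    Fin.init_snoc ..
  rw [resampled, h1, h2]

open Classical in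
theorem lastTime_snoc (cancel : Bool) {t : ℕ} (h : History V k l t) (S : Snapshot V k l)
    (u : WalkId V k) :
    lastTime cancel (Fin.snoc h S : History V k l (t + 1)) u =
      if u ∈ S.advSampled ∪ landmarkSampled cancel h then t + 1 else lastTime cancel h u := by
  have h2 : (Fin.init (Fin.snoc h S : History V k l (t + 1)) : History V k l t) = h :=
    Fin.init_snoc ..
  simp only [lastTime, resampled_snoc, h2]

open Classical in
theorem load_snoc (cancel : Bool) (L : Set ℕ) (e : Sym2 V) {t : ℕ} (h : History V k l t)
    (S : Snapshot V k l) :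
    load cancel L e (Fin.snoc h S : History V k l (t + 1)) = load cancel L e h +
      if t + 1 ∈ L then
        {u | u ∈ S.advSampled ∪ landmarkSampled cancel h ∧ Traverses (S.walk u) e}.ncard
      else 0 := by
  have h1 : (Fin.snoc h S : History V k l (t + 1)) (Fin.last t) = S := Fin.snoc_last ..
  have h2 : (Fin.init (Fin.snoc h S : History V k l (t + 1)) : History V k l t) = h :=
    Fin.init_snoc ..
  rw [load, resampled_snoc, h1, h2]

theorem currentWalk_snoc {t : ℕ} (h : History V k l t) (S : Snapshot V k l) :
    currentWalk (Fin.snoc h S : History V k l (t + 1)) = S.walk := by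
  have h1 : (Fin.snoc h S : History V k l (t + 1)) (Fin.last t) = S := Fin.snoc_last ..
  funext u
  rw [currentWalk, h1]

theorem lastTime_le (cancel : Bool) {t : ℕ} (h : History V k l t) (u : WalkId V k) :
    lastTime cancel h u ≤ t := by
  induction t with
  | zero => rfl
  | succ t ih =>
    rw [lastTime]
    split_ifs
    exacts [le_rfl, (ih _).trans (Nat.le_succ t)]

/-- A property of histories that holds for the empty history, and is passed on whenever one more
step is played, holds for every history of positive probability. -/
theorem historyLaw_support_induction [Fintype V] {cancel : Bool} {A : Adversary V k l}
    {P : (t : ℕ) → History V k l t → Prop} (h0 : P 0 Fin.elim0)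
    (hs : ∀ t (h : History V k l t), P t h → ∀ w ∈ (nextWalksLaw cancel A h).support,
      P (t + 1) (Fin.snoc h ⟨A.nextGraph h, A.sampled h, w⟩ : Fin (t + 1) → Snapshot V k l))
    {t : ℕ} {h : History V k l t} (hh : h ∈ (historyLaw cancel A t).support) : P t h := by
  induction t with
  | zero =>
    rw [historyLaw, PMF.mem_support_pure_iff] at hh
    rwa [hh]
  | succ t ih =>
    rw [historyLaw, PMF.mem_support_bind_iff] at hh
    obtain ⟨h', hh', hw⟩ := hh
    rw [PMF.mem_support_map_iff] at hw
    obtain ⟨w, hw, rfl⟩ := hw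
    exact hs t h' (ih hh') w hw

theorem snoc_mem_support [Fintype V] {cancel : Bool} {A : Adversary V k l} {t : ℕ}
    {h : History V k l t} (hh : h ∈ (historyLaw cancel A t).support)
    {w : WalkId V k → Fin (l + 1) → V} (hw : w ∈ (nextWalksLaw cancel A h).support) :
    (Fin.snoc h ⟨A.nextGraph h, A.sampled h, w⟩ : Fin (t + 1) → Snapshot V k l) ∈
      (historyLaw cancel A (t + 1)).support := by
  rw [historyLaw, PMF.mem_support_bind_iff]
  refine ⟨h, hh, ?_⟩
  rw [PMF.mem_support_map_iff]
  exact ⟨w, hw, rfl⟩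

theorem eq_currentWalk_of_mem_support [Fintype V] {cancel : Bool} {A : Adversary V k l} {t : ℕ}
    {h : History V k l t} {w : WalkId V k → Fin (l + 1) → V}
    (hw : w ∈ (nextWalksLaw cancel A h).support) {u : WalkId V k}
    (hu : u ∉ A.sampled h ∪ landmarkSampled cancel h) : w u = currentWalk h u := by
  rw [PMF.mem_support_iff, nextWalksLaw, productLaw_apply, Finset.prod_ne_zero_iff] at hw
  have := hw u (Finset.mem_univ u)
  rw [if_neg hu, ← PMF.mem_support_iff, PMF.mem_support_pure_iff] at this
  exact this

/-- The last resampling of every walk belongs to a schedule that is still in force and whose next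
resampling lies in the future. -/
theorem exists_schedule_of_mem_support [Fintype V] {cancel : Bool} {A : Adversary V k l} {t : ℕ}
    {h : History V k l t} (hh : h ∈ (historyLaw cancel A t).support) (ht : 0 < t)
    (u : WalkId V k) :
    ∃ (s : Fin t) (i : ℕ), u ∈ (h s).advSampled ∧
      (cancel = true → ∀ s' : Fin t, s < s' → u ∉ (h s').advSampled) ∧
      landmarkTime (s + 1) i = lastTime cancel h u ∧ t < landmarkTime (s + 1) (i + 1) := by
  refine historyLaw_support_induction (cancel := cancel) (A := A)
    (P := fun t h => 0 < t → ∃ (s : Fin t) (i : ℕ), u ∈ (h s).advSampled ∧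
      (cancel = true → ∀ s' : Fin t, s < s' → u ∉ (h s').advSampled) ∧
      landmarkTime (s + 1) i = lastTime cancel h u ∧ t < landmarkTime (s + 1) (i + 1))
    (fun h => absurd h (lt_irrefl 0)) ?_ hh ht
  intro t h ih w _ _
  set S : Snapshot V k l := ⟨A.nextGraph h, A.sampled h, w⟩
  have hlast : (Fin.snoc h S : History V k l (t + 1)) (Fin.last t) = S := Fin.snoc_last ..
  have hcast (s : Fin t) : (Fin.snoc h S : History V k l (t + 1)) s.castSucc = h s :=
    Fin.snoc_castSucc ..
  by_cases hadv : u ∈ S.advSampled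
  · refine ⟨Fin.last t, 0, by rwa [hlast], fun _ s' hs' => ?_, ?_, landmarkTime_lt_succ (t + 1) 0⟩
    · exact absurd hs' (Fin.le_last s').not_gt
    · rw [lastTime_snoc, if_pos (Set.mem_union_left _ hadv)]
      rfl
  -- A schedule that is in force at time `t` is not cancelled at time `t + 1`.
  have hkeep (s : Fin t) (hc : cancel = true → ∀ s' : Fin t, s < s' → u ∉ (h s').advSampled) :
      cancel = true → ∀ s' : Fin (t + 1), s.castSucc < s' →
        u ∉ ((Fin.snoc h S : History V k l (t + 1)) s').advSampled := by
    intro hcan s' hs'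
    induction s' using Fin.lastCases with
    | last => rwa [hlast]
    | cast s' =>
      rw [hcast]
      exact hc hcan s' (Fin.castSucc_lt_castSucc_iff.1 hs')
  by_cases hlm : u ∈ landmarkSampled cancel h
  · obtain ⟨s, hs, hc, i, -, hi⟩ := id hlm
    refine ⟨s.castSucc, i, by rwa [hcast], hkeep s hc, ?_, ?_⟩
    · rw [lastTime_snoc, if_pos (Set.mem_union_right _ hlm)]
      exact hi
    · exact hi.symm.trans_lt (landmarkTime_lt_succ _ _)
  · have ht : 0 < t := by
      rcases t with _ | t
      · exact absurd (Set.mem_univ u) hadv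
      · exact Nat.succ_pos t
    obtain ⟨s, i, hs, hc, hi, hlt⟩ := ih ht
    refine ⟨s.castSucc, i, by rwa [hcast], hkeep s hc, ?_, ?_⟩
    · rw [lastTime_snoc, if_neg (by simp only [Set.mem_union, hadv, hlm, or_self,
        not_false_eq_true])]
      exact hi
    · refine lt_of_le_of_ne hlt fun heq => hlm ⟨s, hs, hc, i + 1, Nat.succ_pos i, heq.symm⟩

theorem lastTime_mem_landmarks [Fintype V] {cancel : Bool} {A : Adversary V k l} {t : ℕ}
    {h : History V k l t} (hh : h ∈ (historyLaw cancel A t).support) (ht : 0 < t)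
    (u : WalkId V k) : lastTime cancel h u ∈ landmarks t := by
  obtain ⟨s, i, -, -, hi, hlt⟩ := exists_schedule_of_mem_support hh ht u
  rw [← hi]
  refine ⟨(Nat.succ_pos s).trans_le (le_landmarkTime _ i), ?_, i, two_pow_dvd_landmarkTime _ i,
    hlt.trans_le (landmarkNext_bounds (i + 1) _).2⟩
  rw [hi]
  exact lastTime_le cancel h u

theorem ncard_le_load [Fintype V] {cancel : Bool} {A : Adversary V k l} {t : ℕ}
    {h : History V k l t} (hh : h ∈ (historyLaw cancel A t).support) {L : Set ℕ} (hL : 0 ∉ L)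
    (e : Sym2 V) :
    {u | lastTime cancel h u ∈ L ∧ Traverses (currentWalk h u) e}.ncard ≤ load cancel L e h := by
  refine historyLaw_support_induction (cancel := cancel) (A := A)
    (P := fun t h => {u | lastTime cancel h u ∈ L ∧ Traverses (currentWalk h u) e}.ncard ≤
      load cancel L e h) ?_ ?_ hh
  · simp [lastTime, hL]
  intro t h ih w hw
  rw [load_snoc]
  refine le_trans ?_ (Nat.add_le_add_right ih _)
  simp_rw [lastTime_snoc, currentWalk_snoc]
  split_ifs with htL
  · refine le_trans (Set.ncard_le_ncard ?_ (Set.toFinite _)) (Set.ncard_union_le _ _)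
    rintro u ⟨hu, htr⟩
    by_cases hmem : u ∈ A.sampled h ∪ landmarkSampled cancel h
    · exact Or.inr ⟨hmem, htr⟩
    · rw [if_neg hmem] at hu
      rw [eq_currentWalk_of_mem_support hw hmem] at htr
      exact Or.inl ⟨hu, htr⟩
  · refine Set.ncard_le_ncard ?_ (Set.toFinite _)
    rintro u ⟨hu, htr⟩
    by_cases hmem : u ∈ A.sampled h ∪ landmarkSampled cancel h
    · rw [if_pos hmem] at hu
      exact absurd hu htL
    · rw [if_neg hmem] at hu
      rw [eq_currentWalk_of_mem_support hw hmem] at htr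
      exact ⟨hu, htr⟩

theorem congestion_le_load [Fintype V] {cancel : Bool} {A : Adversary V k l} {t : ℕ}
    {h : History V k l (t + 1)} (hh : h ∈ (historyLaw cancel A (t + 1)).support) (e : Sym2 V) :
    (h (Fin.last t)).congestion e ≤ load cancel (landmarks (t + 1)) e h := by
  refine le_trans (Set.ncard_le_ncard ?_ (Set.toFinite _))
    (ncard_le_load hh (fun h0 => lt_irrefl 0 h0.1) e)
  exact fun u hu => ⟨lastTime_mem_landmarks hh (Nat.succ_pos t) u, hu⟩

/-! ### The exponential moment of the load -/

theorem tsum_bind_mul {α β : Type*} (p : PMF α) (f : α → PMF β) (g : β → ℝ≥0∞) :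
    ∑' b, p.bind f b * g b = ∑' a, p a * ∑' b, f a b * g b := by
  simp_rw [PMF.bind_apply, ← ENNReal.tsum_mul_right, ← ENNReal.tsum_mul_left]
  rw [ENNReal.tsum_comm]
  simp_rw [mul_assoc]

theorem tsum_map_mul {α β : Type*} (p : PMF α) (f : α → β) (g : β → ℝ≥0∞) :
    ∑' b, p.map f b * g b = ∑' a, p a * g (f a) := by
  rw [PMF.map, tsum_bind_mul]
  refine tsum_congr fun a => ?_
  rw [tsum_eq_single (f a)]
  · simp
  · intro b hb
    simp [PMF.pure_apply, hb]

/-- Markov's inequality. -/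
theorem mul_toOuterMeasure_le_tsum {α : Type*} (p : PMF α) (f : α → ℝ≥0∞) (s : Set α)
    (b : ℝ≥0∞) (hs : ∀ a ∈ s ∩ p.support, b ≤ f a) :
    b * p.toOuterMeasure s ≤ ∑' a, p a * f a := by
  rw [PMF.toOuterMeasure_apply, ← ENNReal.tsum_mul_left]
  refine ENNReal.tsum_le_tsum fun a => ?_
  by_cases ha : a ∈ s
  · rw [Set.indicator_of_mem ha, mul_comm]
    by_cases hp : a ∈ p.support
    · exact mul_le_mul_right (hs a ⟨ha, hp⟩) _
    · rw [PMF.apply_eq_zero_iff p a |>.2 hp]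
      simp
  · rw [Set.indicator_of_notMem ha, mul_zero]
    exact zero_le

/-- The degree condition passes from the histories of positive probability of length `T` to
those of length `t + 1 ≤ T`, because each of the latter can be continued. -/
theorem le_ncard_neighborSet_nextGraph [Fintype V] {cancel : Bool} {A : Adversary V k l} {T : ℕ}
    (hT : ∀ h ∈ (historyLaw cancel A T).support, ∀ (s : Fin T) (v : V),
      k v ≤ ((h s).graph.neighborSet v).ncard) {t : ℕ} (ht : t < T) :
    ∀ h ∈ (historyLaw cancel A t).support, ∀ v,
      k v ≤ ((A.nextGraph h).neighborSet v).ncard := by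
  have hall : ∀ t ≤ T, ∀ h ∈ (historyLaw cancel A t).support, ∀ (s : Fin t) (v : V),
      k v ≤ ((h s).graph.neighborSet v).ncard := by
    intro t ht
    induction ht using Nat.decreasingInduction with
    | self => exact hT
    | of_succ t _ ih =>
      intro h hh s v
      obtain ⟨w, hw⟩ := (nextWalksLaw cancel A h).support_nonempty
      have := ih _ (snoc_mem_support hh hw) s.castSucc v
      rwa [Fin.snoc_castSucc (α := fun _ => Snapshot V k l)] at this
  intro h hh v
  obtain ⟨w, hw⟩ := (nextWalksLaw cancel A h).support_nonempty
  have := hall (t + 1) ht _ (snoc_mem_support hh hw) (Fin.last t) v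
  rwa [Fin.snoc_last (α := fun _ => Snapshot V k l)] at this

open Classical in
/-- However the adversary plays, each time in `L` contributes at most a factor `exp (2 * l)` to
the exponential moment of the load, because the conditional bound
`tsum_productLaw_mul_two_pow_le` holds for every past. -/
theorem tsum_historyLaw_mul_two_pow_load_le [Fintype V] {cancel : Bool} {A : Adversary V k l}
    {T : ℕ} (hT : ∀ h ∈ (historyLaw cancel A T).support, ∀ (s : Fin T) (v : V),
      k v ≤ ((h s).graph.neighborSet v).ncard) (L : Set ℕ) (e : Sym2 V) {t : ℕ} (ht : t ≤ T) :
    ∑' h, historyLaw cancel A t h * 2 ^ load cancel L e h ≤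
      ENNReal.ofReal (Real.exp (2 * l)) ^ ((Finset.Icc 1 t).filter (· ∈ L)).card := by
  induction t with
  | zero =>
    rw [historyLaw, tsum_eq_single Fin.elim0]
    · simp [load]
    · intro h hh
      exact absurd (Subsingleton.elim _ _) hh
  | succ t ih =>
    rw [historyLaw, tsum_bind_mul]
    simp_rw [tsum_map_mul, load_snoc, pow_add]
    rw [← Finset.insert_Icc_right_eq_Icc_add_one (Nat.le_add_left 1 t), Finset.filter_insert]
    by_cases htL : t + 1 ∈ L
    · simp_rw [if_pos htL]
      rw [Finset.card_insert_of_notMem (by simp), pow_succ]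
      calc _ ≤ ∑' h, (historyLaw cancel A t h * 2 ^ load cancel L e h) *
              ENNReal.ofReal (Real.exp (2 * l)) := by
            refine ENNReal.tsum_le_tsum fun h => ?_
            by_cases hh : h ∈ (historyLaw cancel A t).support
            · rw [mul_assoc]
              gcongr
              simp_rw [fun x y : ℝ≥0∞ => mul_left_comm x (2 ^ load cancel L e h) y]
              rw [ENNReal.tsum_mul_left]
              gcongr
              exact tsum_productLaw_mul_two_pow_le (A.nextGraph h)
                (le_ncard_neighborSet_nextGraph hT ht h hh) l e _ _ fun u hu => if_pos hu
            · rw [PMF.apply_eq_zero_iff _ h |>.2 hh]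
              simp
        _ ≤ _ := by
            rw [ENNReal.tsum_mul_right]
            gcongr
            exact ih (Nat.le_of_succ_le ht)
    · simp_rw [if_neg htL, pow_zero, mul_one, ENNReal.tsum_mul_right, PMF.tsum_coe, one_mul]
      exact ih (Nat.le_of_succ_le ht)

/-! ### The tail bound -/

theorem natLog_two_add_one_le {T : ℕ} (hT : 2 ≤ T) :
    ((Nat.log 2 T + 1 : ℕ) : ℝ) ≤ 3 * Real.log T := by
  have hT0 : (0 : ℝ) < T := by positivity
  have h1 : (Nat.log 2 T : ℝ) * Real.log 2 ≤ Real.log T := by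
    rw [← Real.log_pow]
    exact Real.log_le_log (by positivity) (by exact_mod_cast Nat.pow_log_le_self 2 (by omega))
  have h2 : Real.log 2 ≤ Real.log T := Real.log_le_log two_pos (by exact_mod_cast hT)
  have h3 := Real.log_two_gt_d9
  push_cast
  nlinarith

/-- The tail of the congestion of a single edge. The exponent `24 * l * log (t + 1)` is the product of
the contribution `2 * l` of one time and the number `12 * log (t + 1)` of relevant times. -/
theorem toOuterMeasure_lt_congestion_le [Fintype V] {cancel : Bool} {A : Adversary V k l} {t : ℕ}
    (ht : 2 ≤ t + 1)
    (hk : ∀ h ∈ (historyLaw cancel A (t + 1)).support, ∀ (s : Fin (t + 1)) (v : V),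
      k v ≤ ((h s).graph.neighborSet v).ncard) (e : Sym2 V) (B : ℝ) :
    (historyLaw cancel A (t + 1)).toOuterMeasure
        {h | B < ((h (Fin.last t)).congestion e : ℝ)} ≤
      ENNReal.ofReal (Real.exp (24 * l * Real.log (t + 1 : ℕ) - B * Real.log 2)) := by
  classical
  have hM := (mul_toOuterMeasure_le_tsum (historyLaw cancel A (t + 1)) (fun h => 2 ^ load cancel
    (landmarks (t + 1)) e h) {h | B < ((h (Fin.last t)).congestion e : ℝ)}
    (ENNReal.ofReal (Real.exp (B * Real.log 2))) ?_).trans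
    (tsum_historyLaw_mul_two_pow_load_le hk (landmarks (t + 1)) e le_rfl)
  · have hcard := (card_filter_landmarks_le (t + 1))
    have hlog := natLog_two_add_one_le ht
    set N := ((Finset.Icc 1 (t + 1)).filter (· ∈ landmarks (t + 1))).card
    have hN : (N : ℝ) ≤ 12 * Real.log (t + 1 : ℕ) := by
      have : (N : ℝ) ≤ 4 * ((Nat.log 2 (t + 1) + 1 : ℕ) : ℝ) := by exact_mod_cast hcard
      linarith
    have hpow : ENNReal.ofReal (Real.exp (2 * l)) ^ N ≤
        ENNReal.ofReal (Real.exp (24 * l * Real.log (t + 1 : ℕ))) := by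
      rw [← ENNReal.ofReal_pow (Real.exp_pos _).le, ← Real.exp_nat_mul]
      refine ENNReal.ofReal_le_ofReal (Real.exp_le_exp.2 ?_)
      have := mul_le_mul_of_nonneg_right hN (by positivity : (0 : ℝ) ≤ 2 * l)
      linarith
    rw [Real.exp_sub, ENNReal.ofReal_div_of_pos (Real.exp_pos _), ENNReal.le_div_iff_mul_le
      (Or.inl (by simpa using Real.exp_pos _)) (Or.inl ENNReal.ofReal_ne_top), mul_comm]
    exact hM.trans hpow
  · rintro h ⟨hB, hh⟩
    have hload : B ≤ (load cancel (landmarks (t + 1)) e h : ℝ) :=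
      (le_of_lt hB).trans (by exact_mod_cast congestion_le_load hh e)
    have h2 : (2 : ℝ≥0∞) = ENNReal.ofReal 2 := by simp
    rw [h2, ← ENNReal.ofReal_pow zero_le_two]
    refine ENNReal.ofReal_le_ofReal ?_
    calc Real.exp (B * Real.log 2)
        ≤ Real.exp (load cancel (landmarks (t + 1)) e h * Real.log 2) := by
          gcongr
      _ = _ := by rw [Real.exp_nat_mul, Real.exp_log two_pos]

theorem ofReal_one_sub_le_toOuterMeasure {α : Type*} (p : PMF α) (s : Set α) {ε : ℝ}
    (hε : 0 ≤ ε) (h : p.toOuterMeasure sᶜ ≤ ENNReal.ofReal ε) :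
    ENNReal.ofReal (1 - ε) ≤ p.toOuterMeasure s := by
  rw [ENNReal.ofReal_sub _ hε, ENNReal.ofReal_one, tsub_le_iff_right]
  refine le_trans ?_ (add_le_add_right h _)
  have huniv : p.toOuterMeasure Set.univ = 1 := by
    rw [PMF.toOuterMeasure_apply_eq_one_iff]
    exact Set.subset_univ _
  rw [← huniv, ← Set.union_compl_self s]
  exact MeasureTheory.measure_union_le s sᶜ

/-- The tail of the congestion of all edges, by a union bound over all pairs of vertices. -/
theorem toOuterMeasure_compl_forall_congestion_le [Fintype V] {cancel : Bool}
    {A : Adversary V k l} {t : ℕ} (ht : 2 ≤ t + 1)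
    (hk : ∀ h ∈ (historyLaw cancel A (t + 1)).support, ∀ (s : Fin (t + 1)) (v : V),
      k v ≤ ((h s).graph.neighborSet v).ncard) (B : ℝ) :
    (historyLaw cancel A (t + 1)).toOuterMeasure
        {h | ∀ e ∈ (h (Fin.last t)).graph.edgeSet, ((h (Fin.last t)).congestion e : ℝ) ≤ B}ᶜ ≤
      ENNReal.ofReal (((Fintype.card V * Fintype.card V : ℕ) : ℝ) *
        Real.exp (24 * l * Real.log (t + 1 : ℕ) - B * Real.log 2)) := by
  have hsub : {h : History V k l (t + 1) |
      ∀ e ∈ (h (Fin.last t)).graph.edgeSet, ((h (Fin.last t)).congestion e : ℝ) ≤ B}ᶜ ⊆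
      ⋃ z : V × V, {h | B < ((h (Fin.last t)).congestion s(z.1, z.2) : ℝ)} := by
    intro h hh
    simp only [Set.mem_compl_iff, Set.mem_ofPred_eq, not_forall, not_le] at hh
    obtain ⟨e, -, he⟩ := hh
    induction e using Sym2.inductionOn with
    | _ x y => exact Set.mem_iUnion.2 ⟨(x, y), he⟩
  refine (MeasureTheory.measure_mono hsub).trans ?_
  refine (MeasureTheory.measure_iUnion_le _).trans ?_
  have hedge (z : V × V) : (historyLaw cancel A (t + 1)).toOuterMeasure
      {h | B < ((h (Fin.last t)).congestion s(z.1, z.2) : ℝ)} ≤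
      ENNReal.ofReal (Real.exp (24 * l * Real.log (t + 1 : ℕ) - B * Real.log 2)) :=
    toOuterMeasure_lt_congestion_le ht hk s(z.1, z.2) B
  refine (ENNReal.tsum_le_tsum hedge).trans (le_of_eq ?_)
  rw [tsum_fintype, Finset.sum_const, Finset.card_univ, Fintype.card_prod, nsmul_eq_mul,
    ← ENNReal.ofReal_natCast, ← ENNReal.ofReal_mul (by positivity)]

/-- The choice of the constant: the union bound over all pairs of vertices costs a factor `n ^ 2`. -/
theorem card_sq_mul_exp_le {c : ℝ} (hc : 0 ≤ c) {l t n : ℕ} (hl : 0 < l) (hT : 2 ≤ t + 1)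
    (hn2 : 2 ≤ n) :
    ((n * n : ℕ) : ℝ) * Real.exp (24 * l * Real.log (t + 1 : ℕ) -
      (104 + 4 * c) * (Real.log (t + 1 : ℕ) * Real.log n) * l * Real.log 2) ≤
      (n : ℝ) ^ (-c) := by
  have hn0 : (0 : ℝ) < n := by positivity
  have hlog2 : (1 / 2 : ℝ) ≤ Real.log 2 := by linarith [Real.log_two_gt_d9]
  have hlogT : 1 / 2 ≤ Real.log (t + 1 : ℕ) :=
    hlog2.trans (Real.log_le_log two_pos (by exact_mod_cast hT))
  have hlogn : 1 / 2 ≤ Real.log n :=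
    hlog2.trans (Real.log_le_log two_pos (by exact_mod_cast hn2))
  have hl1 : (1 : ℝ) ≤ l := by exact_mod_cast hl
  have hnn : ((n * n : ℕ) : ℝ) = Real.exp (2 * Real.log n) := by
    rw [two_mul, Real.exp_add, Real.exp_log hn0]
    push_cast
    rfl
  rw [hnn, ← Real.exp_add, Real.rpow_def_of_pos hn0]
  refine Real.exp_le_exp.2 ?_
  set a := Real.log (t + 1 : ℕ)
  set b := Real.log n
  -- As `l ≥ 1` and both logarithms are at least `1 / 2`, both `l * a` and `b` are at most
  -- `2 * (l * a * b)`, and a fraction `1 / 2` of the constant is lost to the factor `log 2`.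
  have hQ1 : l * a ≤ 2 * (l * a * b) := by
    have : 0 ≤ l * a * (2 * b - 1) :=
      mul_nonneg (mul_nonneg (by positivity) (by linarith)) (by linarith)
    linarith
  have hQ2 : b ≤ 2 * (l * a * b) := by
    have h1 : 1 / 2 ≤ l * a := by nlinarith
    have : 0 ≤ b * (2 * (l * a) - 1) := mul_nonneg (by linarith) (by linarith)
    linarith
  have hQ3 : (104 + 4 * c) * (l * a * b) * (1 / 2) ≤
      (104 + 4 * c) * (l * a * b) * Real.log 2 := by
    refine mul_le_mul_of_nonneg_left hlog2 (mul_nonneg (by linarith) ?_)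
    linarith
  have hQ4 := mul_le_mul_of_nonneg_left hQ2 hc
  linarith

end DynamicWalks

theorem mainTheorem9 (c : ℝ) (hc : 0 < c) :
    ∃ C : ℝ, 0 < C ∧
      ∀ (V : Type*) [Fintype V] (k : V → ℕ) (l T : ℕ) (hT : 2 ≤ T) (cancel : Bool)
        (A : DynamicWalks.Adversary V k l),
        (∀ h ∈ (DynamicWalks.historyLaw cancel A T).support, ∀ (s : Fin T) (v : V),
          k v ≤ ((h s).graph.neighborSet v).ncard) →
        ENNReal.ofReal (1 - (Fintype.card V : ℝ) ^ (-c)) ≤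
          (DynamicWalks.historyLaw cancel A T).toOuterMeasure
            {h | ∀ e ∈ (h ⟨T - 1, by omega⟩).graph.edgeSet,
              ((h ⟨T - 1, by omega⟩).congestion e : ℝ) ≤
                C * (Real.log T * Real.log (Fintype.card V)) * l} := by
  refine ⟨104 + 4 * c, by linarith, ?_⟩
  intro V _ k l T hT cancel A hk
  obtain ⟨t, rfl⟩ : ∃ t, T = t + 1 := ⟨T - 1, by omega⟩
  refine DynamicWalks.ofReal_one_sub_le_toOuterMeasure _ _ (by positivity) ?_
  rcases Nat.eq_zero_or_pos l with rfl | hl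
  · -- Without steps nothing is traversed.
    refine (le_of_eq ?_).trans zero_le
    convert MeasureTheory.measure_empty (μ := (DynamicWalks.historyLaw cancel A
      (t + 1)).toOuterMeasure) using 2
    ext h
    simp [DynamicWalks.Snapshot.congestion, DynamicWalks.Traverses]
  rcases Nat.lt_or_ge (Fintype.card V) 2 with hn2 | hn2
  · -- Without vertices there are no edges, and with one vertex the claimed probability is zero.
    interval_cases hn : Fintype.card V
    · have : IsEmpty V := Fintype.card_eq_zero_iff.1 hn
      refine (le_of_eq ?_).trans zero_le
      convert MeasureTheory.measure_empty (μ := (DynamicWalks.historyLaw cancel A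
        (t + 1)).toOuterMeasure) using 2
      ext h
      simp only [Set.mem_compl_iff, Set.mem_ofPred_eq, Set.mem_empty_iff_false, iff_false, not_not]
      intro e
      induction e using Sym2.inductionOn with
      | _ x y => exact isEmptyElim x
    · refine (DynamicWalks.toOuterMeasure_le_one _ _).trans ?_
      simp
  refine (DynamicWalks.toOuterMeasure_compl_forall_congestion_le hT hk _).trans
    (ENNReal.ofReal_le_ofReal ?_)
  exact DynamicWalks.card_sq_mul_exp_le hc.le hl hT hn2
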